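/- Let $s,k,P$ be positive integers and let $\mathbf h=(h_1,\dots,h_k)\in\mathbb Z^k$. Denote by $U_{s,k}(P;\mathbf h)$ the number of integer solutions $(x_1,\dots,x_s)$ of the system \[ \sum_{i=1}^{s}x_i^{2j-1}=h_j\quad(1\le j\le k) \] with $|x_i|\le P$ $(1\le i\le s)$. Suppose that $k\ge 2$, that $1\le t\le k$ and that $\varepsilon>0$. Then there is a constant $C>0$, depending only on $k$, $t$ and $\varepsilon$, such that for every $\mathbf h\in\mathbb Z^k\setminus\{\mathbf 0\}$ and every integer $P\ge 1$, \[ U_{2t,k}(P;\mathbf h)\le C\,P^{\,t-1+\varepsilon}. \] -/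

import Mathlib

/-- The number `U_{s,k}(P; h)` of integral solutions `x = (x_1, …, x_s)` of the Diophantine system
`∑_{i=1}^s x_i^{2j-1} = h_j` for `1 ≤ j ≤ k`, subject to `|x_i| ≤ P` for `1 ≤ i ≤ s`.
The index `j : Fin k` runs from `0` to `k - 1`, so the exponents `2 * j + 1` run over
`1, 3, …, 2k - 1`. -/
noncomputable def oddPowerCount (s k P : ℕ) (h : Fin k → ℤ) : ℕ :=
  ((Fintype.piFinset fun _ : Fin s => Finset.Icc (-(P : ℤ)) (P : ℤ)).filter
    fun x => ∀ j : Fin k, ∑ i : Fin s, x i ^ (2 * (j : ℕ) + 1) = h j).card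

open Polynomial Finset

/-- The polynomial `∏ (X + xᵢ)`. -/
noncomputable def shiftProd {ι : Type} [Fintype ι] (x : ι → ℚ) : ℚ[X] := ∏ i, (X + C (x i))

/-! ### Polynomial relations between solutions, over the rationals -/

section shiftProd

variable {ι : Type} [Fintype ι]

theorem shiftProd_monic (x : ι → ℚ) : (shiftProd x).Monic :=
  monic_prod_of_monic _ _ fun i _ => monic_X_add_C (x i)

theorem shiftProd_natDegree (x : ι → ℚ) : (shiftProd x).natDegree = Fintype.card ι := by
  rw [shiftProd, natDegree_prod_of_monic _ _ fun i _ => monic_X_add_C (x i)]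
  simp

theorem shiftProd_degree (x : ι → ℚ) : (shiftProd x).degree = Fintype.card ι := by
  rw [degree_eq_natDegree (shiftProd_monic x).ne_zero, shiftProd_natDegree]

theorem shiftProd_eval (x : ι → ℚ) (y : ℚ) : (shiftProd x).eval y = ∏ i, (y + x i) := by
  simp [shiftProd, eval_prod]

theorem shiftProd_eval_neg_self (x : ι → ℚ) (i : ι) : (shiftProd x).eval (-x i) = 0 := by
  rw [shiftProd_eval]
  exact prod_eq_zero (mem_univ i) (by simp)

theorem shiftProd_coeff (x : ι → ℚ) {n : ℕ} (h : n ≤ Fintype.card ι) :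
    (shiftProd x).coeff n =
      MvPolynomial.aeval x (MvPolynomial.esymm ι ℚ (Fintype.card ι - n)) := by
  rw [MvPolynomial.aeval_esymm_eq_multiset_esymm, shiftProd, prod_eq_multiset_prod,
    Multiset.prod_X_add_C_coeff' _ _ (by simpa using h)]
  simp

/-- A tuple is determined up to order by its polynomial; in particular its values are. -/
theorem exists_eq_of_shiftProd_eq {x a : ι → ℚ} (h : shiftProd x = shiftProd a) (i : ι) :
    ∃ j, x i = a j := by
  have := shiftProd_eval_neg_self x i
  rw [h, shiftProd_eval, prod_eq_zero_iff] at this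
  obtain ⟨j, -, hj⟩ := this
  exact ⟨j, by linarith⟩

theorem shiftProd_neg_coeff (x : ι → ℚ) {n : ℕ} (h : n ≤ Fintype.card ι) :
    (shiftProd (-x)).coeff n = (-1) ^ (Fintype.card ι - n) * (shiftProd x).coeff n := by
  rw [shiftProd_coeff _ h, shiftProd_coeff _ h, MvPolynomial.aeval_esymm_eq_multiset_esymm,
    MvPolynomial.aeval_esymm_eq_multiset_esymm, ← Multiset.esymm_neg, Multiset.map_map]
  rfl

theorem shiftProd_neg_eval (x : ι → ℚ) (y : ℚ) :
    (shiftProd (-x)).eval y = (-1) ^ Fintype.card ι * (shiftProd x).eval (-y) := by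
  rw [shiftProd_eval, shiftProd_eval, ← card_univ, ← prod_const, ← prod_mul_distrib]
  refine prod_congr rfl fun i _ => ?_
  simp only [Pi.neg_apply]
  ring

/-- If the power sums of odd degree below `2k` vanish, then so do the elementary symmetric
functions of odd degree below `2k`. -/
theorem aeval_esymm_eq_zero_of_odd {k : ℕ} (u : ι → ℚ)
    (hu : ∀ j < k, ∑ i, u i ^ (2 * j + 1) = 0) {m : ℕ} (hm : Odd m) (hmk : m < 2 * k) :
    MvPolynomial.aeval u (MvPolynomial.esymm ι ℚ m) = 0 := by
  induction m using Nat.strong_induction_on with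
  | _ m ih =>
  have key := congrArg (MvPolynomial.aeval u) (MvPolynomial.mul_esymm_eq_sum ι ℚ m)
  have hsum : ∑ a ∈ antidiagonal m with a.1 < m, MvPolynomial.aeval u
      ((-1) ^ a.1 * MvPolynomial.esymm ι ℚ a.1 * MvPolynomial.psum ι ℚ a.2) = 0 := by
    refine sum_eq_zero fun a ha => ?_
    simp only [mem_filter, HasAntidiagonal.mem_antidiagonal] at ha
    -- In a splitting of an odd m one part is odd: either the power sum vanishes by hypothesis or
    -- the elementary symmetric function does by induction.
    rcases Nat.even_or_odd a.1 with he | ho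
    · obtain ⟨j, hj⟩ : Odd a.2 := by
        rw [← ha.1] at hm
        exact (Nat.odd_add'.1 hm).2 he
      have : MvPolynomial.aeval u (MvPolynomial.psum ι ℚ a.2) = 0 := by
        simpa [MvPolynomial.psum, hj] using hu j (by omega)
      rw [map_mul, this, mul_zero]
    · rw [map_mul, map_mul, ih a.1 ha.2 ho (by omega), mul_zero, zero_mul]
  rw [map_mul, map_mul, map_sum, hsum, mul_zero, map_natCast] at key
  have hm0 : (m : ℚ) ≠ 0 := by exact_mod_cast hm.pos.ne'
  exact (mul_eq_zero.1 key).resolve_left hm0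

/-- The odd part of `∏ (X + uᵢ)` is linear when sufficiently many odd power sums vanish. -/
theorem exists_shiftProd_sub_neg {k : ℕ} (u : ι → ℚ) (heven : Even (Fintype.card ι))
    (hcard : Fintype.card ι ≤ 2 * k + 2) (hu : ∀ j < k, ∑ i, u i ^ (2 * j + 1) = 0) :
    ∃ c : ℚ, shiftProd u - shiftProd (-u) = C c * X ∧ (Fintype.card ι ≤ 2 * k → c = 0) := by
  have key : ∀ n, n ≠ 1 ∨ Fintype.card ι ≤ 2 * k →
      (shiftProd u - shiftProd (-u)).coeff n = 0 := by
    intro n h1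
    rw [coeff_sub]
    by_cases hn : n ≤ Fintype.card ι
    · rw [shiftProd_neg_coeff _ hn]
      rcases Nat.even_or_odd (Fintype.card ι - n) with he | ho
      · simp [he.neg_one_pow]
      · rw [shiftProd_coeff _ hn, aeval_esymm_eq_zero_of_odd u hu ho]
        · simp
        -- The odd number card - n is below 2k unless n = 1 and card = 2k + 2, which is the excluded
        -- case.
        · obtain ⟨p, hp⟩ := heven
          obtain ⟨q, hq⟩ := ho
          omega
    · rw [coeff_eq_zero_of_natDegree_lt, coeff_eq_zero_of_natDegree_lt, sub_zero] <;>
        rw [shiftProd_natDegree] <;> omega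
  refine ⟨(shiftProd u - shiftProd (-u)).coeff 1, ?_, fun h => key 1 (.inr h)⟩
  ext n
  rw [coeff_C_mul, coeff_X]
  split_ifs with h1
  · subst h1; simp
  · rw [mul_zero, key n (.inl (Ne.symm h1))]

theorem shiftProd_sumElim {κ : Type} [Fintype κ] (x : ι → ℚ) (a : κ → ℚ) :
    shiftProd (Sum.elim x a) = shiftProd x * shiftProd a := by
  simp [shiftProd, Fintype.prod_sum_type]

/-- Odd powers turn equal sums for x and a into vanishing sums for the concatenation (x, -a), whose
polynomial is the product f_x f_{-a}. -/
theorem exists_mul_neg_sub_mul_neg {k : ℕ} (hcard : Fintype.card ι ≤ k + 1) {x a : ι → ℚ}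
    (h : ∀ j < k, ∑ i, x i ^ (2 * j + 1) = ∑ i, a i ^ (2 * j + 1)) :
    ∃ c : ℚ, shiftProd x * shiftProd (-a) - shiftProd (-x) * shiftProd a = C c * X ∧
      (Fintype.card ι ≤ k → c = 0) := by
  obtain ⟨c, hc, hc0⟩ := exists_shiftProd_sub_neg (k := k) (Sum.elim x (-a))
    (by rw [Fintype.card_sum]; exact ⟨_, rfl⟩) (by rw [Fintype.card_sum]; omega) (fun j hj => by
      simp [Fintype.sum_sum_type, h j hj, Odd.neg_pow ⟨j, rfl⟩])
  refine ⟨c, ?_, fun h => hc0 (by rw [Fintype.card_sum]; omega)⟩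
  rw [← hc, shiftProd_sumElim, show -Sum.elim x (-a) = Sum.elim (-x) a by
    ext (i | i) <;> simp, shiftProd_sumElim]

theorem isCoprime_shiftProd_neg {a : ι → ℚ} (ha : ∀ i j, a i + a j ≠ 0) :
    IsCoprime (shiftProd a) (shiftProd (-a)) := by
  refine IsCoprime.prod_left fun i _ => IsCoprime.prod_right fun j _ => ?_
  have := isCoprime_X_sub_C_of_isUnit_sub (a := -a i) (b := a j)
    (IsUnit.mk0 _ fun h => ha i j (by linarith))
  simpa [sub_eq_add_neg] using this

theorem shiftProd_sub_degree_lt (x a : ι → ℚ) :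
    (shiftProd x - shiftProd a).degree < Fintype.card ι := by
  rw [← shiftProd_degree x]
  exact degree_sub_lt_left (by rw [shiftProd_degree, shiftProd_degree])
    (shiftProd_monic x).ne_zero (by rw [(shiftProd_monic x).leadingCoeff,
      (shiftProd_monic a).leadingCoeff])

/-- Two polynomials satisfying the same linear relation modulo a coprime pair are proportional. -/
theorem smul_sub_eq_smul_sub {x a b : ι → ℚ} (ha : ∀ i j, a i + a j ≠ 0) {c d : ℚ}
    (hx : shiftProd x * shiftProd (-a) - shiftProd (-x) * shiftProd a = C c * X)
    (hb : shiftProd b * shiftProd (-a) - shiftProd (-b) * shiftProd a = C d * X) :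
    C d * (shiftProd x - shiftProd a) = C c * (shiftProd b - shiftProd a) := by
  set E := C d * (shiftProd x - shiftProd a) - C c * (shiftProd b - shiftProd a) with hE
  -- Eliminating X between the two relations leaves a multiple of f_a; the degree of E is too small
  -- for f_a to divide it unless E = 0.
  have hdvd : shiftProd a ∣ E * shiftProd (-a) := by
    refine ⟨C d * (shiftProd (-x) - shiftProd (-a)) - C c * (shiftProd (-b) - shiftProd (-a)), ?_⟩
    rw [hE]
    linear_combination C d * hx - C c * hb
  have hlt : ∀ (e : ℚ) (y : ι → ℚ), (C e * (shiftProd y - shiftProd a)).degree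
      < Fintype.card ι := fun e y =>
    (degree_mul_le_of_le degree_C_le le_rfl).trans_lt
      (by rw [zero_add]; exact shiftProd_sub_degree_lt y a)
  have hE0 : E = 0 := by
    refine eq_zero_of_dvd_of_degree_lt ((isCoprime_shiftProd_neg ha).dvd_of_dvd_mul_right hdvd) ?_
    rw [shiftProd_degree]
    exact (degree_sub_le _ _).trans_lt (max_lt (hlt d x) (hlt c b))
  exact sub_eq_zero.1 hE0

/-- The case c = 0 of the relation: f_a divides f_b by coprimality, and both are monic of the same
degree. -/
theorem shiftProd_eq_of_mul_neg_eq {b a : ι → ℚ} (ha : ∀ i j, a i + a j ≠ 0)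
    (hb : shiftProd b * shiftProd (-a) = shiftProd (-b) * shiftProd a) :
    shiftProd b = shiftProd a := by
  have h : shiftProd a ∣ shiftProd b :=
    (isCoprime_shiftProd_neg ha).dvd_of_dvd_mul_right ⟨shiftProd (-b), by rw [hb]; ring⟩
  exact (eq_of_monic_of_dvd_of_natDegree_le (shiftProd_monic a) (shiftProd_monic b) h
    (by rw [shiftProd_natDegree, shiftProd_natDegree]))

/-- The product `∏ D(-xᵢ)` (a resultant) only depends on `∏ (X + xᵢ)` modulo `D`. -/
theorem prod_eval_neg_eq {x a : ι → ℚ} {D : ℚ[X]} (h : D ∣ shiftProd x - shiftProd a) :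
    ∏ i, D.eval (-x i) = ∏ i, D.eval (-a i) := by
  obtain ⟨p, hp⟩ := h
  have hres : ∀ y : ι → ℚ, ∏ i, D.eval (-y i) =
      (shiftProd y).resultant D (Fintype.card ι) D.natDegree := fun y => by
    rw [← shiftProd_natDegree y, shiftProd, resultant_prod_left _ _ _ _ (by simp) le_rfl]
    simp
  rw [hres, hres, sub_eq_iff_eq_add'.1 hp]
  rcases eq_or_ne (D * p) 0 with h0 | h0
  · rw [h0, add_zero]
  -- The formal degrees are held fixed, so adding a multiple of D needs deg D + deg p to stay within
  -- the formal degree.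
  · refine resultant_add_mul_left _ _ _ _ _ ?_ le_rfl
    have hlt := shiftProd_sub_degree_lt x a
    rw [hp, degree_eq_natDegree h0, natDegree_mul (left_ne_zero_of_mul h0)
      (right_ne_zero_of_mul h0)] at hlt
    have : D.natDegree + p.natDegree < Fintype.card ι := by exact_mod_cast hlt
    omega

end shiftProd

/-! ### The divisor bound and signed divisors -/

theorem add_one_le_mul_rpow {δ : ℝ} (hδ : 0 < δ) {p : ℕ} (hp : 2 ≤ p) (e : ℕ) :
    (e + 1 : ℝ) ≤ (1 + 1 / (δ * Real.log 2)) * ((p ^ e : ℕ) : ℝ) ^ δ := by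
  have hl : 0 < δ * Real.log 2 := mul_pos hδ (Real.log_pos one_lt_two)
  have h2 : 1 + e * (δ * Real.log 2) ≤ ((p ^ e : ℕ) : ℝ) ^ δ := by
    calc 1 + e * (δ * Real.log 2) ≤ Real.exp (e * (δ * Real.log 2)) := by
          rw [add_comm]; exact Real.add_one_le_exp _
      _ = ((2 : ℝ) ^ e) ^ δ := by
          rw [Real.rpow_def_of_pos (by positivity), Real.log_pow]
          ring_nf
      _ ≤ _ := by
          push_cast
          gcongr
          exact_mod_cast hp
  refine le_trans ?_ (mul_le_mul_of_nonneg_left h2 (by positivity))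
  have : (1 + 1 / (δ * Real.log 2)) * (1 + e * (δ * Real.log 2)) =
      1 + e + 1 / (δ * Real.log 2) + e * (δ * Real.log 2) := by
    field_simp
    ring
  rw [this]
  have h3 : 0 ≤ 1 / (δ * Real.log 2) := by positivity
  have h4 : 0 ≤ e * (δ * Real.log 2) := by positivity
  linarith

/-- Here p^δ ≥ 2, so no constant is lost; only the boundedly many smaller primes contribute one to
the divisor bound. -/
theorem add_one_le_rpow_of_large {δ : ℝ} (hδ : 0 < δ) {p : ℕ} (hp : (2 : ℝ) ^ (1 / δ) ≤ p)
    (e : ℕ) : (e + 1 : ℝ) ≤ ((p ^ e : ℕ) : ℝ) ^ δ := by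
  have h2 : (2 : ℝ) ≤ (p : ℝ) ^ δ := by
    calc (2 : ℝ) = ((2 : ℝ) ^ (1 / δ)) ^ δ := by
          rw [← Real.rpow_mul (by norm_num), one_div, inv_mul_cancel₀ hδ.ne', Real.rpow_one]
      _ ≤ _ := by gcongr
  calc (e + 1 : ℝ) ≤ 2 ^ e := by exact_mod_cast Nat.succ_le_of_lt e.lt_two_pow_self
    _ ≤ ((p : ℝ) ^ δ) ^ e := by gcongr
    _ = _ := by
      push_cast
      rw [← Real.rpow_mul_natCast (by positivity), mul_comm, Real.rpow_natCast_mul (by positivity)]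

/-- The divisor bound `d(n) ≪ n ^ δ`. -/
theorem exists_card_divisors_le {δ : ℝ} (hδ : 0 < δ) :
    ∃ C : ℝ, 1 ≤ C ∧ ∀ n : ℕ, n ≠ 0 → (n.divisors.card : ℝ) ≤ C * (n : ℝ) ^ δ := by
  set K : ℝ := 1 + 1 / (δ * Real.log 2) with hK
  have hK1 : 1 ≤ K := by
    have : 0 < δ * Real.log 2 := mul_pos hδ (Real.log_pos one_lt_two)
    have : 0 ≤ 1 / (δ * Real.log 2) := by positivity
    linarith
  set M : ℕ := ⌈(2 : ℝ) ^ (1 / δ)⌉₊ with hM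
  refine ⟨K ^ M, one_le_pow₀ hK1, fun n hn => ?_⟩
  have hn' : (n : ℝ) ^ δ = ∏ p ∈ n.primeFactors, ((p ^ n.factorization p : ℕ) : ℝ) ^ δ := by
    rw [Real.finsetProd_rpow _ _ fun _ _ => Nat.cast_nonneg _, ← Nat.cast_prod]
    congr 2
    exact (Nat.prod_factorization_pow_eq_self hn).symm
  have hsmall : ∏ p ∈ n.primeFactors, (if p < M then K else 1) ≤ K ^ M := by
    rw [← prod_filter, prod_const]
    refine pow_le_pow_right₀ hK1 ?_
    calc _ ≤ (range M).card := card_le_card fun p hp => by simpa using (mem_filter.1 hp).2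
      _ = M := card_range M
  rw [Nat.card_divisors hn, Nat.cast_prod]
  calc ∏ p ∈ n.primeFactors, ((n.factorization p + 1 : ℕ) : ℝ)
      ≤ ∏ p ∈ n.primeFactors, (if p < M then K else 1) *
          ((p ^ n.factorization p : ℕ) : ℝ) ^ δ := by
        refine prod_le_prod (fun _ _ => Nat.cast_nonneg _) fun p hp => ?_
        push_cast
        split_ifs with h
        · exact_mod_cast add_one_le_mul_rpow hδ (Nat.prime_of_mem_primeFactors hp).two_le _
        · rw [one_mul]
          exact_mod_cast add_one_le_rpow_of_large hδ (Nat.ceil_le.1 (not_lt.1 h)) _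
    _ ≤ K ^ M * (n : ℝ) ^ δ := by
        rw [prod_mul_distrib, ← hn']
        gcongr

/-- The divisors of `n` of either sign. -/
def signedDivisors (n : ℕ) : Finset ℤ :=
  n.divisors.image (fun d : ℕ => (d : ℤ)) ∪ n.divisors.image (fun d : ℕ => -(d : ℤ))

theorem card_signedDivisors_le (n : ℕ) : (signedDivisors n).card ≤ 2 * n.divisors.card := by
  have h1 := card_image_le (s := n.divisors) (f := fun d : ℕ => (d : ℤ))
  have h2 := card_image_le (s := n.divisors) (f := fun d : ℕ => -(d : ℤ))
  have h3 := card_union_le (n.divisors.image fun d : ℕ => (d : ℤ))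
    (n.divisors.image fun d : ℕ => -(d : ℤ))
  rw [signedDivisors]
  omega

theorem mem_signedDivisors {z N : ℤ} (hN : N ≠ 0) (h : z ∣ N) :
    z ∈ signedDivisors N.natAbs := by
  have hd : z.natAbs ∈ N.natAbs.divisors :=
    Nat.mem_divisors.2 ⟨Int.natAbs_dvd_natAbs.2 h, Int.natAbs_ne_zero.2 hN⟩
  rw [signedDivisors, mem_union, mem_image, mem_image]
  rcases Int.natAbs_eq z with hz | hz
  · exact .inl ⟨_, hd, hz.symm⟩
  · exact .inr ⟨_, hd, hz.symm⟩

theorem card_filter_eval_neg_le {D : ℚ[X]} (hD : D.natDegree ≠ 0) (V : Finset ℤ) (z : ℚ) :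
    (V.filter fun v : ℤ => D.eval (-(v : ℚ)) = z).card ≤ D.natDegree := by
  have h0 : D - C z ≠ 0 := fun h => hD (by rw [sub_eq_zero.1 h, natDegree_C])
  calc (V.filter fun v : ℤ => D.eval (-(v : ℚ)) = z).card
      ≤ (D - C z).roots.toFinset.card := by
        refine card_le_card_of_injOn (fun v : ℤ => -(v : ℚ)) (fun v hv => ?_) (fun v _ w _ h => ?_)
        · have := (mem_filter.1 hv).2
          simp [h0, this]
        · simpa using h
    _ ≤ Multiset.card (D - C z).roots := Multiset.toFinset_card_le _
    _ ≤ (D - C z).natDegree := card_roots' _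
    _ = D.natDegree := natDegree_sub_C

/-! ### Solutions without cancellation in at most k + 1 variables -/

/-- `x` is a solution in the box of the odd power sum system. -/
def IsSol {ι : Type} [Fintype ι] {k : ℕ} (P : ℕ) (h : Fin k → ℤ) (x : ι → ℤ) : Prop :=
  (∀ i, |x i| ≤ P) ∧ ∀ j : Fin k, ∑ i, x i ^ (2 * (j : ℕ) + 1) = h j

/-- No two (possibly equal) coordinates of `x` cancel. -/
def NoCancel {ι : Type} (x : ι → ℤ) : Prop := ∀ i j, x i + x j ≠ 0

theorem NoCancel.cast {ι : Type} {x : ι → ℤ} (hx : NoCancel x) (i j : ι) : (x i : ℚ) + x j ≠ 0 := by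
  exact_mod_cast hx i j

theorem IsSol.exists_relation {ι : Type} [Fintype ι] {k P : ℕ} {h : Fin k → ℤ}
    (hcard : Fintype.card ι ≤ k + 1)
    {x a : ι → ℤ} (hx : IsSol P h x) (ha : IsSol P h a) :
    ∃ c : ℚ, shiftProd (fun i => (x i : ℚ)) * shiftProd (-fun i => (a i : ℚ)) -
      shiftProd (-fun i => (x i : ℚ)) * shiftProd (fun i => (a i : ℚ)) = C c * X ∧
      (Fintype.card ι ≤ k → c = 0) :=
  exists_mul_neg_sub_mul_neg hcard fun j hj => by
    have := (hx.2 ⟨j, hj⟩).trans (ha.2 ⟨j, hj⟩).symm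
    exact_mod_cast this

/-- At X = -aᵢ = -bⱼ the left side of the relation vanishes, while c X does not. This makes the
resultant N nonzero. -/
theorem ne_of_relation {ι : Type} [Fintype ι] {a b : ι → ℚ} {c : ℚ} (hc : c ≠ 0)
    (ha : ∀ i j, a i + a j ≠ 0)
    (hb : shiftProd b * shiftProd (-a) - shiftProd (-b) * shiftProd a = C c * X) (i j : ι) :
    b j ≠ a i := by
  intro hij
  have hev := congrArg (eval (-a i)) hb
  have hbz : (shiftProd b).eval (-a i) = 0 := hij ▸ shiftProd_eval_neg_self b j
  simp only [eval_sub, eval_mul, hbz, shiftProd_eval_neg_self, eval_C, eval_X] at hev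
  have := ha i i
  have hai : a i ≠ 0 := fun h0 => this (by rw [h0, add_zero])
  simp [hc, hai] at hev

/-- If `D = ∏ (X + bᵢ) - ∏ (X + aᵢ)` is constant, then `∏_{j ≠ i} (xᵢ + xⱼ)` is the same
for all `i` and all solutions `x`. -/
theorem prod_erase_add_eq {ι : Type} [Fintype ι] [DecidableEq ι] {a b x : ι → ℚ}
    {c d e : ℚ} (hc : c ≠ 0) (hd : d ≠ 0)
    (ha : ∀ i j, a i + a j ≠ 0) (hx0 : ∀ i j, x i + x j ≠ 0)
    (hb : shiftProd b * shiftProd (-a) - shiftProd (-b) * shiftProd a = C c * X)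
    (hx : shiftProd x * shiftProd (-a) - shiftProd (-x) * shiftProd a = C e * X)
    (hD : shiftProd b - shiftProd a = C d) (i : ι) :
    ∏ j ∈ univ.erase i, (x i + x j) = -c / (2 * ((-1) ^ Fintype.card ι * d)) := by
  have hs : ((-1 : ℚ) ^ Fintype.card ι) ≠ 0 := by simp
  have hprop := smul_sub_eq_smul_sub ha hx hb
  have hev := congrArg (eval (x i)) hb
  have hD1 := congrArg (eval (x i)) hD
  have hD2 := congrArg (eval (-x i)) hD
  have hp1 := congrArg (eval (x i)) hprop
  have hp2 := congrArg (eval (-x i)) hprop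
  simp only [eval_sub, eval_mul, shiftProd_neg_eval, eval_C, eval_X, shiftProd_eval_neg_self]
    at hev hD1 hD2 hp1 hp2
  set s := (-1 : ℚ) ^ Fintype.card ι
  -- f_x - f_a is constant and f_x vanishes at -xᵢ, so its value at xᵢ is a difference of values of
  -- f_a.
  have h1 : (shiftProd x).eval (x i) =
      (shiftProd a).eval (x i) - (shiftProd a).eval (-x i) := by
    refine mul_left_cancel₀ hc ?_
    linear_combination hp1 - hp2 + e * hD1 - e * hD2
  have h2 : s * d * (shiftProd x).eval (x i) = -c * x i := by
    rw [h1]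
    linear_combination -hev + s * (shiftProd a).eval (-x i) * hD1 -
      s * (shiftProd a).eval (x i) * hD2
  rw [shiftProd_eval, ← mul_prod_erase _ _ (mem_univ i)] at h2
  have hxi : x i ≠ 0 := fun h0 => hx0 i i (by rw [h0, add_zero])
  rw [eq_div_iff (mul_ne_zero two_ne_zero (mul_ne_zero hs hd))]
  refine mul_left_cancel₀ hxi ?_
  linear_combination h2

theorem exists_two_ne_of_three_le_card {ι : Type} [Fintype ι] [DecidableEq ι]
    (h : 3 ≤ Fintype.card ι) (i : ι) :
    ∃ j l, i ≠ j ∧ i ≠ l ∧ j ≠ l := by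
  obtain ⟨j, hj⟩ := Fintype.exists_ne_of_one_lt_card (by omega) i
  obtain ⟨l, -, hl⟩ := exists_mem_notMem_of_card_lt_card (s := {i, j}) (t := univ)
    (card_le_two.trans_lt (by rw [card_univ]; omega))
  simp only [mem_insert, mem_singleton, not_or] at hl
  exact ⟨j, l, hj.symm, Ne.symm hl.1, Ne.symm hl.2⟩

theorem natAbs_prod_le {κ : Type} (s : Finset κ) (f : κ → ℤ) {Q : ℕ} (h : ∀ i ∈ s, |f i| ≤ Q) :
    (∏ i ∈ s, f i).natAbs ≤ Q ^ s.card := by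
  rw [← Int.natAbsHom_apply, map_prod]
  refine prod_le_pow_card _ _ _ fun i hi => ?_
  have := h i hi
  rw [Int.abs_eq_natAbs] at this
  exact_mod_cast this

/-- The coordinates of the solutions without cancellation lie in a small set. -/
theorem exists_finset_coordinates {ι : Type} [Fintype ι] [DecidableEq ι]
    {k P : ℕ} (hk : 2 ≤ k) (hP : 1 ≤ P)
    (hcard : Fintype.card ι ≤ k + 1) (h : Fin k → ℤ) :
    ∃ N : ℕ, N ≠ 0 ∧ N ≤ (2 * P) ^ (k + 1) ^ 2 ∧ ∃ V : Finset ℤ,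
      V.card ≤ (k + 1) * (2 * N.divisors.card) ^ 3 ∧
      ∀ x : ι → ℤ, IsSol P h x → NoCancel x → ∀ i, x i ∈ V := by
  by_cases hne : ∃ a : ι → ℤ, IsSol P h a ∧ NoCancel a
  swap
  · push Not at hne
    exact ⟨1, one_ne_zero, Nat.one_le_pow _ _ (by omega), ∅, by simp,
      fun x hx hx' => absurd hx' (hne x hx)⟩
  obtain ⟨a, ha, ha0⟩ := hne
  by_cases hall : ∀ b : ι → ℤ, IsSol P h b → NoCancel b →
      shiftProd (fun i => (b i : ℚ)) = shiftProd fun i => (a i : ℚ)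
  · refine ⟨1, one_ne_zero, Nat.one_le_pow _ _ (by omega), univ.image a, ?_, fun x hx hx0 i => ?_⟩
    · have := card_image_le (s := univ) (f := a)
      rw [card_univ] at this
      simp only [Nat.divisors_one, card_singleton]
      omega
    · obtain ⟨j, hj⟩ := exists_eq_of_shiftProd_eq (hall x hx hx0) i
      exact mem_image.2 ⟨j, mem_univ j, by exact_mod_cast hj.symm⟩
  push Not at hall
  obtain ⟨b, hb, -, hba⟩ := hall
  obtain ⟨c, hc, hck⟩ := hb.exists_relation hcard ha
  have hc0 : c ≠ 0 := by
    rintro rfl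
    refine hba (shiftProd_eq_of_mul_neg_eq ha0.cast ?_)
    rw [C_0, zero_mul] at hc
    exact sub_eq_zero.1 hc
  -- Since k ≥ 2, two or fewer variables would force c = 0.
  have hcard3 : 3 ≤ Fintype.card ι := by
    by_contra hlt
    exact hc0 (hck (by omega))
  set D := shiftProd (fun i => (b i : ℚ)) - shiftProd (fun i => (a i : ℚ)) with hD
  have hDne : D ≠ 0 := sub_ne_zero.2 hba
  have hpow : ∀ n ≤ (k + 1) ^ 2, (2 * P) ^ n ≤ (2 * P) ^ (k + 1) ^ 2 := fun n hn =>
    Nat.pow_le_pow_right (by omega) hn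
  by_cases hdeg : D.natDegree = 0
  · obtain ⟨d, hd⟩ := natDegree_eq_zero.1 hdeg
    have hd0 : d ≠ 0 := by rintro rfl; exact hDne (by rw [← hd, C_0])
    obtain ⟨i₀⟩ : Nonempty ι := Fintype.card_pos_iff.1 (by omega)
    set N : ℤ := ∏ j ∈ univ.erase i₀, (a i₀ + a j) with hN
    have hN0 : N ≠ 0 := prod_ne_zero_iff.2 fun j _ => ha0 i₀ j
    have hprod : ∀ x : ι → ℤ, IsSol P h x → NoCancel x → ∀ i,
        ∏ j ∈ univ.erase i, (x i + x j) = N := by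
      intro x hx hx0 i
      obtain ⟨e, he, -⟩ := hx.exists_relation hcard ha
      obtain ⟨e', he', -⟩ := ha.exists_relation hcard ha
      have h1 := prod_erase_add_eq hc0 hd0 ha0.cast hx0.cast hc he hd.symm i
      have h2 := prod_erase_add_eq hc0 hd0 ha0.cast ha0.cast hc he' hd.symm i₀
      have h3 := h1.trans h2.symm
      rw [hN]
      exact_mod_cast h3
    refine ⟨N.natAbs, Int.natAbs_ne_zero.2 hN0, ?_,
      -- Three pairwise sums recover a coordinate: 2xᵢ = (xᵢ + xⱼ) + (xᵢ + xₗ) - (xⱼ + xₗ). Hence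
      -- the cube in the bound for V.
      ((signedDivisors N.natAbs ×ˢ signedDivisors N.natAbs) ×ˢ signedDivisors N.natAbs).image
        fun u => (u.1.1 + u.1.2 - u.2) / 2, ?_, fun x hx hx0 i => ?_⟩
    · refine (natAbs_prod_le _ _ (Q := 2 * P) fun j _ => ?_).trans (hpow _ ?_)
      · have := ha.1 i₀
        have := ha.1 j
        have := abs_add_le (a i₀) (a j)
        push_cast
        linarith
      · rw [card_erase_of_mem (mem_univ _), card_univ]
        nlinarith [Nat.sub_le (Fintype.card ι) 1]
    · refine card_image_le.trans ?_
      rw [card_product, card_product]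
      have := card_signedDivisors_le N.natAbs
      calc _ = (signedDivisors N.natAbs).card ^ 3 := by ring
        _ ≤ (2 * N.natAbs.divisors.card) ^ 3 := by gcongr
        _ ≤ _ := Nat.le_mul_of_pos_left _ (by omega)
    · obtain ⟨j, l, hij, hil, hjl⟩ := exists_two_ne_of_three_le_card hcard3 i
      have hmem : ∀ i j, i ≠ j → x i + x j ∈ signedDivisors N.natAbs := fun i j hij => by
        refine mem_signedDivisors hN0 ?_
        rw [← hprod x hx hx0 i]
        exact dvd_prod_of_mem (fun j => x i + x j) (mem_erase.2 ⟨hij.symm, mem_univ j⟩)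
      refine mem_image.2 ⟨((x i + x j, x i + x l), x j + x l), ?_, ?_⟩
      · simp only [mem_product]
        exact ⟨⟨hmem i j hij, hmem i l hil⟩, hmem j l hjl⟩
      · simp only
        omega
  · set Δ : ℤ → ℤ := fun v => ∏ j, (-v + b j) - ∏ j, (-v + a j) with hΔ
    have hDΔ : ∀ v : ℤ, D.eval (-(v : ℚ)) = Δ v := fun v => by
      rw [hD, eval_sub, shiftProd_eval, shiftProd_eval]
      simp [hΔ]
    set N : ℤ := ∏ i, Δ (a i) with hN
    have hΔa : ∀ i, Δ (a i) = ∏ j, (-a i + b j) := fun i => by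
      simp only [hΔ]
      rw [prod_eq_zero (f := fun j => -a i + a j) (mem_univ i) (by ring), sub_zero]
    have hN0 : N ≠ 0 := by
      refine prod_ne_zero_iff.2 fun i _ => ?_
      rw [hΔa]
      refine prod_ne_zero_iff.2 fun j _ h0 => ne_of_relation hc0 ha0.cast hc i j ?_
      have : b j = a i := by omega
      exact_mod_cast this
    have hprod : ∀ x : ι → ℤ, IsSol P h x → NoCancel x → ∏ i, Δ (x i) = N := by
      intro x hx hx0
      obtain ⟨e, he, -⟩ := hx.exists_relation hcard ha
      have hprop := smul_sub_eq_smul_sub ha0.cast he hc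
      have hdvd : D ∣ shiftProd (fun i => (x i : ℚ)) - shiftProd (fun i => (a i : ℚ)) := by
        refine ⟨C (c⁻¹ * e), ?_⟩
        calc _ = C c⁻¹ * (C c * (shiftProd (fun i => (x i : ℚ)) -
              shiftProd (fun i => (a i : ℚ)))) := by
              rw [← mul_assoc, ← C_mul, inv_mul_cancel₀ hc0, C_1, one_mul]
          _ = _ := by rw [hprop, C_mul]; ring
      have := prod_eval_neg_eq hdvd
      simp only [hDΔ] at this
      rw [hN]
      exact_mod_cast this
    set V : Finset ℤ := (Icc (-(P : ℤ)) P).filter fun v => Δ v ∈ signedDivisors N.natAbs with hV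
    refine ⟨N.natAbs, Int.natAbs_ne_zero.2 hN0, ?_, V, ?_, fun x hx hx0 i => ?_⟩
    · refine (natAbs_prod_le _ _ (Q := (2 * P) ^ Fintype.card ι) fun i _ => ?_).trans ?_
      · rw [hΔa, Int.abs_eq_natAbs]
        have := natAbs_prod_le univ (fun j => -a i + b j) (Q := 2 * P) fun j _ => by
          have := ha.1 i
          have := hb.1 j
          have := abs_add_le (-a i) (b j)
          rw [abs_neg] at this
          push_cast
          linarith
        rw [card_univ] at this
        exact_mod_cast this
      · rw [card_univ, ← pow_mul]
        exact hpow _ (by rw [sq]; gcongr)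
    -- Each value of the nonconstant D is taken at most deg D ≤ k + 1 times.
    · have h1 : V.card ≤ (k + 1) * (V.image Δ).card := by
        refine card_le_mul_card_image _ _ fun z _ => ?_
        have h2 := card_filter_eval_neg_le hdeg V z
        simp only [hDΔ, Int.cast_inj] at h2
        refine h2.trans (le_trans ?_ hcard)
        have := natDegree_sub_le (shiftProd fun i => (b i : ℚ)) (shiftProd fun i => (a i : ℚ))
        rwa [shiftProd_natDegree, shiftProd_natDegree, max_self] at this
      have h2 : (V.image Δ).card ≤ 2 * N.natAbs.divisors.card := by
        refine (card_le_card (image_subset_iff.2 fun v hv => ?_)).trans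
          (card_signedDivisors_le N.natAbs)
        exact (mem_filter.1 hv).2
      refine h1.trans (Nat.mul_le_mul_left _ (h2.trans ?_))
      exact Nat.le_self_pow (by norm_num) _
    · refine mem_filter.2 ⟨mem_Icc.2 (abs_le.1 (hx.1 i)), mem_signedDivisors hN0 ?_⟩
      rw [← hprod x hx hx0]
      exact dvd_prod_of_mem (fun i => Δ (x i)) (mem_univ i)

/-- For at most `k + 1` variables, the solutions without cancellation are `O(P ^ ε)` in number. -/
theorem exists_card_noCancel_le {k : ℕ} (hk : 2 ≤ k) {ε : ℝ} (hε : 0 < ε) :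
    ∃ K : ℝ, 1 ≤ K ∧ ∀ (ι : Type) [Fintype ι] [DecidableEq ι], Fintype.card ι ≤ k + 1 →
      ∀ (h : Fin k → ℤ) (P : ℕ), 1 ≤ P → ∀ S : Finset (ι → ℤ),
        (∀ x ∈ S, IsSol P h x ∧ NoCancel x) → (S.card : ℝ) ≤ K * (P : ℝ) ^ ε := by
  -- Three divisor factors for each of k + 1 coordinates, with N ≤ (2P)^((k+1)²), give total
  -- exponent 3(k + 1)³δ = ε.
  set δ : ℝ := ε / (3 * (k + 1) ^ 3) with hδ
  obtain ⟨C, hC, hdiv⟩ := exists_card_divisors_le (δ := δ) (by positivity)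
  refine ⟨(((k : ℝ) + 1) * (2 * C) ^ 3) ^ (k + 1) * 2 ^ ε, ?_, fun ι _ _ hcard h P hP S hS => ?_⟩
  · refine one_le_mul_of_one_le_of_one_le (one_le_pow₀ ?_) (Real.one_le_rpow (by norm_num) hε.le)
    exact one_le_mul_of_one_le_of_one_le (by linarith [(Nat.cast_nonneg k : (0 : ℝ) ≤ k)])
      (one_le_pow₀ (by linarith))
  obtain ⟨N, hN0, hN, V, hV, hmem⟩ := exists_finset_coordinates hk hP hcard h
  have hQ : (1 : ℝ) ≤ ((2 * P : ℕ) : ℝ) := by exact_mod_cast (by omega : 1 ≤ 2 * P)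
  have hd1 : 1 ≤ N.divisors.card := card_pos.2 ⟨1, Nat.one_mem_divisors.2 hN0⟩
  have hSV : S.card ≤ ((k + 1) * (2 * N.divisors.card) ^ 3) ^ (k + 1) := by
    calc S.card ≤ (Fintype.piFinset fun _ : ι => V).card :=
          card_le_card fun x hx => Fintype.mem_piFinset.2 (hmem x (hS x hx).1 (hS x hx).2)
      _ = V.card ^ Fintype.card ι := by simp
      _ ≤ ((k + 1) * (2 * N.divisors.card) ^ 3) ^ Fintype.card ι := Nat.pow_le_pow_left hV _
      _ ≤ _ := Nat.pow_le_pow_right (Nat.mul_pos (by omega) (pow_pos (by omega) _)) hcard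
  have hd : (N.divisors.card : ℝ) ≤ C * ((2 * P : ℕ) : ℝ) ^ (((k : ℝ) + 1) ^ 2 * δ) := by
    refine (hdiv N hN0).trans (mul_le_mul_of_nonneg_left ?_ (by linarith))
    calc (N : ℝ) ^ δ ≤ (((2 * P : ℕ) : ℝ) ^ (k + 1) ^ 2) ^ δ := by
          gcongr
          exact_mod_cast hN
      _ = _ := by
          rw [← Real.rpow_natCast_mul (by positivity)]
          push_cast
          rfl
  calc (S.card : ℝ) ≤ (((k : ℝ) + 1) * (2 * N.divisors.card) ^ 3) ^ (k + 1) := by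
        exact_mod_cast hSV
    _ ≤ (((k : ℝ) + 1) *
          (2 * (C * ((2 * P : ℕ) : ℝ) ^ (((k : ℝ) + 1) ^ 2 * δ))) ^ 3) ^ (k + 1) := by
        gcongr
    _ = (((k : ℝ) + 1) * (2 * C) ^ 3) ^ (k + 1) *
        ((((2 * P : ℕ) : ℝ) ^ (((k : ℝ) + 1) ^ 2 * δ)) ^ 3) ^ (k + 1) := by
        rw [← mul_pow]
        ring
    _ = (((k : ℝ) + 1) * (2 * C) ^ 3) ^ (k + 1) * ((2 * P : ℕ) : ℝ) ^ ε := by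
        rw [← Real.rpow_mul_natCast (by positivity), ← Real.rpow_mul_natCast (by positivity)]
        congr 2
        rw [hδ]
        push_cast
        field_simp
    _ = _ := by
        push_cast
        rw [Real.mul_rpow (by norm_num) (by positivity), mul_assoc]

/-! ### Fixing coordinates and removing cancellations -/

/-- Counting solutions by fixing the coordinates in `I`. -/
theorem card_le_mul_of_restrict {ι : Type} [Fintype ι] [DecidableEq ι] {k P : ℕ} {h : Fin k → ℤ}
    (I : Finset ι) (S : Finset (ι → ℤ)) (hS : ∀ x ∈ S, IsSol P h x) (F : Finset (I → ℤ))
    (hF : ∀ x ∈ S, (fun i : I => x i) ∈ F) {B : ℝ}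
    (hB : ∀ y ∈ F, ∀ T : Finset ({i // i ∉ I} → ℤ),
      (∀ z ∈ T, IsSol P (fun j => h j - ∑ i, y i ^ (2 * (j : ℕ) + 1)) z ∧
        ∃ x ∈ S, z = fun i : {i // i ∉ I} => x i) → (T.card : ℝ) ≤ B) :
    (S.card : ℝ) ≤ F.card * B := by
  rw [card_eq_sum_card_fiberwise (f := fun x (i : I) => x i) (t := F)
    (fun x hx => hF x hx), Nat.cast_sum,
    ← nsmul_eq_mul]
  refine sum_le_card_nsmul _ _ _ fun y hy => ?_
  rw [← card_image_of_injOn (f := fun x (i : {i // i ∉ I}) => x i)]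
  · refine hB y hy _ fun z hz => ?_
    obtain ⟨x, hx, rfl⟩ := mem_image.1 hz
    obtain ⟨hxS, hxy⟩ := mem_filter.1 hx
    refine ⟨⟨fun i => (hS x hxS).1 i, fun j => ?_⟩, x, hxS, rfl⟩
    beta_reduce
    rw [← (hS x hxS).2 j, ← hxy]
    refine eq_sub_of_add_eq' ?_
    convert Fintype.sum_subtype_add_sum_subtype (fun i => i ∈ I)
      fun i => x i ^ (2 * (j : ℕ) + 1)
  · intro x hx x' hx' hxx
    have h1 := (mem_filter.1 hx).2.trans (mem_filter.1 hx').2.symm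
    funext i
    by_cases hi : i ∈ I
    · exact congrFun h1 ⟨i, hi⟩
    · exact congrFun hxx ⟨i, hi⟩

theorem card_box_le {ι : Type} [Fintype ι] [DecidableEq ι] {P s : ℕ} (hP : 1 ≤ P)
    (h : Fintype.card ι ≤ s) :
    ((Fintype.piFinset fun _ : ι => Icc (-(P : ℤ)) P).card : ℝ) ≤ 3 ^ s * (P : ℝ) ^ s := by
  rw [← mul_pow]
  have h1 : (Icc (-(P : ℤ)) P).card ≤ 3 * P := by
    rw [Int.card_Icc]
    omega
  have : (Fintype.piFinset fun _ : ι => Icc (-(P : ℤ)) P).card ≤ (3 * P) ^ s := by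
    rw [Fintype.card_piFinset, prod_const, card_univ]
    exact (Nat.pow_le_pow_left h1 _).trans (Nat.pow_le_pow_right (by omega) h)
  exact_mod_cast this

theorem exists_card_noCancel_le_pow {k : ℕ} (hk : 2 ≤ k) {ε : ℝ} (hε : 0 < ε) (s : ℕ) :
    ∃ K : ℝ, 1 ≤ K ∧ ∀ (ι : Type) [Fintype ι] [DecidableEq ι], Fintype.card ι ≤ k + 1 + s →
      ∀ (h : Fin k → ℤ) (P : ℕ), 1 ≤ P → ∀ S : Finset (ι → ℤ),
        (∀ x ∈ S, IsSol P h x ∧ NoCancel x) → (S.card : ℝ) ≤ K * (P : ℝ) ^ ((s : ℝ) + ε) := by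
  obtain ⟨K, hK, hbound⟩ := exists_card_noCancel_le hk hε
  refine ⟨3 ^ s * K, one_le_mul_of_one_le_of_one_le (one_le_pow₀ (by norm_num)) hK,
    fun ι _ _ hcard h P hP S hS => ?_⟩
  have hP0 : (0 : ℝ) < P := by exact_mod_cast hP
  obtain ⟨I, -, hI⟩ := exists_subset_card_eq
    (s := (univ : Finset ι)) (n := min s (Fintype.card ι)) (by simp [card_univ])
  have hIc : Fintype.card {i // i ∉ I} ≤ k + 1 := by
    rw [Fintype.card_subtype_compl, Fintype.card_coe]
    omega
  have := card_le_mul_of_restrict I S (fun x hx => (hS x hx).1)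
    (Fintype.piFinset fun _ => Icc (-(P : ℤ)) P)
    (fun x hx => Fintype.mem_piFinset.2 fun i => mem_Icc.2 (abs_le.1 ((hS x hx).1.1 i)))
    (B := K * (P : ℝ) ^ ε) (fun y _ T hT => hbound _ hIc _ P hP T fun z hz => ⟨(hT z hz).1, by
      obtain ⟨-, x, hx, rfl⟩ := hT z hz
      exact fun i j => (hS x hx).2 i j⟩)
  calc (S.card : ℝ) ≤ _ := this
    _ ≤ (3 ^ s * (P : ℝ) ^ s) * (K * (P : ℝ) ^ ε) := by
      refine mul_le_mul_of_nonneg_right (card_box_le hP ?_) (by positivity)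
      rw [Fintype.card_coe]
      omega
    _ = _ := by
      rw [Real.rpow_add hP0, Real.rpow_natCast]
      ring

/-- Solutions in which the coordinates `i` and `j` cancel. -/
theorem card_cancel_le {ι : Type} [Fintype ι] [DecidableEq ι] {k P : ℕ} {h : Fin k → ℤ}
    (hP : 1 ≤ P) {i j : ι} (hij : i ≠ j) (S : Finset (ι → ℤ)) (hS : ∀ x ∈ S, IsSol P h x)
    (hcancel : ∀ x ∈ S, x i + x j = 0) {B : ℝ} (hB0 : 0 ≤ B)
    (hB : ∀ T : Finset ({l // l ∉ ({i, j} : Finset ι)} → ℤ), (∀ z ∈ T, IsSol P h z) →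
      (T.card : ℝ) ≤ B) :
    (S.card : ℝ) ≤ 3 * P * B := by
  set f : ℤ → ι → ℤ := fun v l => if l = i then v else -v with hf
  set F : Finset (({i, j} : Finset ι) → ℤ) :=
    (Icc (-(P : ℤ)) P).image fun v l => f v l with hFdef
  have hFcard : F.card ≤ 3 * P := by
    refine card_image_le.trans ?_
    rw [Int.card_Icc]
    omega
  refine (card_le_mul_of_restrict {i, j} S hS F (fun x hx => ?_) (B := B)
    fun y hy T hT => hB T fun z hz => ?_).trans
      (mul_le_mul_of_nonneg_right (by exact_mod_cast hFcard) hB0)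
  · refine mem_image.2 ⟨x i, mem_Icc.2 (abs_le.1 ((hS x hx).1 i)), ?_⟩
    funext ⟨l, hl⟩
    have := hcancel x hx
    rcases mem_insert.1 hl with rfl | hl
    · simp [hf]
    · rw [mem_singleton] at hl
      subst hl
      simp only [hf, hij.symm, if_false]
      omega
  · obtain ⟨v, -, rfl⟩ := mem_image.1 hy
    have hz := (hT z hz).1
    refine ⟨hz.1, fun m => ?_⟩
    -- A pair v, -v contributes nothing to odd power sums, so the remaining variables solve the
    -- system with the same h.
    have hsum : ∑ l : ({i, j} : Finset ι), f v l ^ (2 * (m : ℕ) + 1) = 0 := by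
      rw [sum_coe_sort {i, j} fun l => f v l ^ (2 * (m : ℕ) + 1), sum_pair hij]
      simp [hf, hij.symm, Odd.neg_pow ⟨(m : ℕ), rfl⟩]
    have := hz.2 m
    beta_reduce at this
    rwa [hsum, sub_zero] at this

/-- Solutions in which the coordinate `i` is zero. -/
theorem card_zero_le {ι : Type} [Fintype ι] [DecidableEq ι] {k P : ℕ} {h : Fin k → ℤ}
    {i : ι} (S : Finset (ι → ℤ)) (hS : ∀ x ∈ S, IsSol P h x) (hzero : ∀ x ∈ S, x i = 0)
    (hne : ∀ x ∈ S, ∀ l m, l ≠ i → m ≠ i → x l + x m ≠ 0) {B : ℝ}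
    (hB : ∀ (h : Fin k → ℤ) (T : Finset ({l // l ∉ ({i} : Finset ι)} → ℤ)),
      (∀ z ∈ T, IsSol P h z ∧ NoCancel z) → (T.card : ℝ) ≤ B) :
    (S.card : ℝ) ≤ B := by
  have := card_le_mul_of_restrict {i} S hS {0} (fun x hx => mem_singleton.2 ?_) (B := B)
    fun y _ T hT => hB _ T fun z hz => ⟨(hT z hz).1, ?_⟩
  · simpa using this
  · funext ⟨l, hl⟩
    rw [mem_singleton] at hl
    subst hl
    exact hzero x hx
  · obtain ⟨-, x, hx, rfl⟩ := hT z hz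
    exact fun l m => hne x hx l m (by simpa using l.2) (by simpa using m.2)

/-- Without a cancelling pair of distinct indices, only a zero coordinate can violate `NoCancel`;
two zeros would themselves cancel, so it is the only one. -/
theorem exists_cancel_or_zero_or_noCancel {ι : Type} (x : ι → ℤ) :
    (∃ i j, i ≠ j ∧ x i + x j = 0) ∨
      (∃ i, x i = 0 ∧ ∀ l m, l ≠ i → m ≠ i → x l + x m ≠ 0) ∨ NoCancel x := by
  by_cases h1 : ∃ i j, i ≠ j ∧ x i + x j = 0
  · exact .inl h1
  refine .inr ?_
  by_cases h2 : NoCancel x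
  · exact .inr h2
  push Not at h1
  simp only [NoCancel, not_forall, not_not] at h2
  obtain ⟨i, j, hij⟩ := h2
  obtain rfl : i = j := by
    by_contra hne
    exact h1 i j hne hij
  have hi : x i = 0 := by omega
  refine .inl ⟨i, hi, fun l m hl hm hlm => ?_⟩
  obtain rfl : l = m := by
    by_contra hne
    exact h1 l m hne hlm
  exact h1 l i hl (by omega)

/-! ### Induction on the number of pairs -/

theorem exists_card_le_of_ne_zero {k : ℕ} (hk : 2 ≤ k) {ε : ℝ} (hε : 0 < ε) (t : ℕ)
    (htk : t ≤ k) :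
    ∃ K : ℝ, 0 < K ∧ ∀ (ι : Type) [Fintype ι] [DecidableEq ι], Fintype.card ι = 2 * t →
      ∀ h : Fin k → ℤ, h ≠ 0 → ∀ P : ℕ, 1 ≤ P → ∀ S : Finset (ι → ℤ),
        (∀ x ∈ S, IsSol P h x) → (S.card : ℝ) ≤ K * (P : ℝ) ^ ((t : ℝ) - 1 + ε) := by
  classical
  induction t with
  | zero =>
    refine ⟨1, one_pos, fun ι _ _ hcard h hh P hP S hS => ?_⟩
    have : IsEmpty ι := Fintype.card_eq_zero_iff.1 (by omega)
    have hS0 : S = ∅ := eq_empty_of_forall_notMem fun x hx =>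
      hh (funext fun j => by simpa using ((hS x hx).2 j).symm)
    rw [hS0, card_empty, Nat.cast_zero]
    positivity
  | succ t ih =>
    obtain ⟨K₁, hK₁, hcancel⟩ := ih (by omega)
    -- With t + 1 ≤ k, the 2(t + 1) variables number at most k + 1 + t, so fixing t of them
    -- suffices.
    obtain ⟨K₂, hK₂, hnocancel⟩ := exists_card_noCancel_le_pow hk hε t
    refine ⟨(2 * t + 2) ^ 2 * (3 * K₁) + (2 * t + 2) * K₂ + K₂, by positivity,
      fun ι _ _ hcard h hh P hP S hS => ?_⟩
    have hP0 : (0 : ℝ) < P := by exact_mod_cast hP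
    set Q : ℝ := (P : ℝ) ^ ((t : ℝ) + ε) with hQ
    have hQ' : (P : ℝ) * (P : ℝ) ^ ((t : ℝ) - 1 + ε) = Q := by
      rw [hQ, show (t : ℝ) + ε = 1 + (t - 1 + ε) by ring, Real.rpow_add hP0 1, Real.rpow_one]
    set S₁ : ι × ι → Finset (ι → ℤ) := fun u =>
      S.filter fun x => u.1 ≠ u.2 ∧ x u.1 + x u.2 = 0 with hS₁
    set S₂ : ι → Finset (ι → ℤ) := fun i =>
      S.filter fun x => x i = 0 ∧ ∀ l m, l ≠ i → m ≠ i → x l + x m ≠ 0 with hS₂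
    set S₃ : Finset (ι → ℤ) := S.filter NoCancel with hS₃
    have hcover : S ⊆ (univ.biUnion S₁ ∪ univ.biUnion S₂) ∪ S₃ := by
      intro x hx
      simp only [mem_union, mem_biUnion, mem_univ, true_and, hS₁, hS₂, hS₃, mem_filter, hx,
        Prod.exists]
      exact or_assoc.2 (exists_cancel_or_zero_or_noCancel x)
    have h₁ : ∀ u, ((S₁ u).card : ℝ) ≤ 3 * K₁ * Q := by
      rintro ⟨i, j⟩
      by_cases hij : i = j
      · simp only [hS₁, hij, ne_eq, not_true_eq_false, false_and, filter_false, card_empty,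
          Nat.cast_zero]
        positivity
      · refine (card_cancel_le hP hij (S₁ (i, j)) (fun x hx => hS x (mem_filter.1 hx).1)
          (fun x hx => (mem_filter.1 hx).2.2) (B := K₁ * (P : ℝ) ^ ((t : ℝ) - 1 + ε))
          (by positivity) fun T hT => hcancel _ ?_ h hh P hP T hT).trans_eq ?_
        · rw [Fintype.card_subtype_compl, Fintype.card_coe, card_pair hij]
          omega
        · rw [← hQ']
          ring
    have h₂ : ∀ i, ((S₂ i).card : ℝ) ≤ K₂ * Q := fun i => by
      refine card_zero_le (S₂ i) (fun x hx => hS x (mem_filter.1 hx).1)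
        (fun x hx => (mem_filter.1 hx).2.1) (fun x hx => (mem_filter.1 hx).2.2)
        fun h' T hT => hnocancel _ ?_ h' P hP T hT
      rw [Fintype.card_subtype_compl, Fintype.card_coe, card_singleton]
      omega
    have h₃ : (S₃.card : ℝ) ≤ K₂ * Q := hnocancel ι (by omega) h P hP S₃ fun x hx =>
      ⟨hS x (mem_filter.1 hx).1, (mem_filter.1 hx).2⟩
    have hcι : (Fintype.card ι : ℝ) = 2 * t + 2 := by
      rw [hcard]
      push_cast
      ring
    have hle : (S.card : ℝ) ≤ ∑ u, ((S₁ u).card : ℝ) + ∑ i, ((S₂ i).card : ℝ) + S₃.card := by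
      have h0 := (card_le_card hcover).trans (card_union_le _ _)
      have h0' := card_union_le (univ.biUnion S₁) (univ.biUnion S₂)
      have h1 := card_biUnion_le (s := univ) (t := S₁)
      have h2 := card_biUnion_le (s := univ) (t := S₂)
      have : S.card ≤ ∑ u, (S₁ u).card + ∑ i, (S₂ i).card + S₃.card := by omega
      exact_mod_cast this
    have hs₁ : ∑ u, ((S₁ u).card : ℝ) ≤ (2 * t + 2) ^ 2 * (3 * K₁ * Q) := by
      have := sum_le_card_nsmul univ _ _ fun u _ => h₁ u
      rw [card_univ, Fintype.card_prod, nsmul_eq_mul, Nat.cast_mul, hcι] at this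
      rwa [sq]
    have hs₂ : ∑ i, ((S₂ i).card : ℝ) ≤ (2 * t + 2) * (K₂ * Q) := by
      have := sum_le_card_nsmul univ _ _ fun i _ => h₂ i
      rwa [card_univ, nsmul_eq_mul, hcι] at this
    rw [show ((t + 1 : ℕ) : ℝ) - 1 + ε = t + ε by push_cast; ring]
    linarith

theorem corollary1p7 (k : ℕ) (hk : 2 ≤ k) (t : ℕ) (ht : 1 ≤ t) (htk : t ≤ k)
    (ε : ℝ) (hε : 0 < ε) :
    ∃ C : ℝ, 0 < C ∧ ∀ h : Fin k → ℤ, h ≠ 0 → ∀ P : ℕ, 1 ≤ P →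
      (oddPowerCount (2 * t) k P h : ℝ) ≤ C * (P : ℝ) ^ ((t : ℝ) - 1 + ε) := by
  obtain ⟨K, hK, hbound⟩ := exists_card_le_of_ne_zero hk hε t htk
  refine ⟨K, hK, fun h hh P hP => hbound (Fin (2 * t)) (by simp) h hh P hP _ fun x hx => ?_⟩
  obtain ⟨hbox, hsum⟩ := mem_filter.1 hx
  exact ⟨fun i => abs_le.2 (mem_Icc.1 (Fintype.mem_piFinset.1 hbox i)), hsum⟩
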